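/- Let $H$ be the triforce graph, i.e. the graph on $6$ vertices and $9$ edges obtained from the triangle $K_3$ by adding, for each of the three pairs of its vertices, a new vertex adjacent to exactly the two vertices of that pair. For $p\in(0,1)$ let $G\sim G(\infty,p)$ be the random graph on the vertex set $\mathbb N$ in which each pair of distinct vertices is an edge independently with probability $p$. An adaptive strategy queries pairs $(u,v)$ one at a time, each time learning whether $(u,v)\in E(G)$, where each query may depend on the previous answers. Let $f(H,p)$ be the least $N$ (such an $N$ exists for all sufficiently small $p>0$) for which some strategy has the property that, with probability at least $1/2$, the edges of $G$ found by its first $N$ queries form a graph containing a copy of $H$ as a (not necessarily induced) subgraph. Write $\log$ for the natural logarithm and $\ell=\ell(p)=\frac{\log(1/p)}{2\log\log(1/p)}$. Then $$f(H,p)=\Omega\!\left(\frac{p^{-2}}{\ell^{4}}\right)\qquad\text{as } p\to 0,$$ i.e. there are absolute constants $c>0$ and $p_0\in(0,1)$ such that $f(H,p)\ge c\,p^{-2}/\ell^4$ for all $0<p<p_0$. -/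

import Mathlib

open MeasureTheory

/-- The triforce graph on 6 vertices and 9 edges: the triangle on `0, 1, 2`, together with a common
neighbour `3` of `0, 1`, a common neighbour `4` of `1, 2`, and a common neighbour `5` of `0, 2`. -/
def triforce : SimpleGraph (Fin 6) :=
  SimpleGraph.fromEdgeSet
    {s(0, 1), s(1, 2), s(0, 2), s(3, 0), s(3, 1), s(4, 1), s(4, 2), s(5, 0), s(5, 2)}

/-- An adaptive querying strategy on the vertex set `ℕ`: given the answers to all previous queries
(oldest first), it names the next pair to be queried. Since the strategy is deterministic, the
previous answers also determine the previous queries. (A query of a diagonal pair is a wasted query: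
the answer is always "no".) -/
abbrev QueryStrategy : Type := List Bool → Sym2 ℕ

namespace QueryStrategy

open Classical in
/-- The answers to the first `n` queries made by the strategy `S` in the graph `G`. -/
noncomputable def answers (S : QueryStrategy) (G : SimpleGraph ℕ) : ℕ → List Bool
  | 0 => []
  | n + 1 => answers S G n ++ [decide (S (answers S G n) ∈ G.edgeSet)]

/-- The `n`-th pair (counting from `0`) queried by the strategy `S` in the graph `G`. -/
noncomputable def query (S : QueryStrategy) (G : SimpleGraph ℕ) (n : ℕ) : Sym2 ℕ :=
  S (S.answers G n)

/-- The graph built by the first `N` queries of the strategy `S` in the graph `G`: its edges are the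
queried pairs that were answered "yes". -/
noncomputable def built (S : QueryStrategy) (G : SimpleGraph ℕ) (N : ℕ) : SimpleGraph ℕ :=
  SimpleGraph.fromEdgeSet {e | e ∈ G.edgeSet ∧ ∃ n < N, S.query G n = e}

end QueryStrategy

/-- A copy of `H` can be found in the random graph `G(ℕ, p)` in `N` queries: some strategy has, with
probability at least `1/2`, built a (not necessarily induced) copy of `H` after `N` queries. -/
def CanFindIn {V : Type*} (H : SimpleGraph V) (p : unitInterval) (N : ℕ) : Prop :=
  ∃ S : QueryStrategy,
    1 / 2 ≤ (SimpleGraph.binomialRandom ℕ p).real {G | H.IsContained (S.built G N)}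

/-- `f(H, p)`: the least number of queries in which a copy of `H` can be found in `G(ℕ, p)` with
probability at least `1/2`. -/
noncomputable def queryNumber {V : Type*} (H : SimpleGraph V) (p : unitInterval) : ℕ :=
  sInf {N : ℕ | CanFindIn H p N}

/-! Record the exploration as a forest. A vertex is discovered by its first edge, whose other end
may become its parent. An edge between two discovered vertices is old. A pair is dangerous when its
ends have a common neighbour that is not the parent of both. As long as no dangerous pair turns out
to be an edge (no hit), every triangle has an apex that is the parent of its other two vertices. The
central triangle of a triforce then has an apex `w` over some side `uv`. The outer triangle on `uv`
also needs an apex, but `u` and `v` already have `w` as their only parent. So a triforce forces a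
hit (`Valid.hit_of_triforce`).

Hits are rare because dangerous pairs are few. A vertex with at most `K` old edges has at most `K +
1` neighbours besides its children, so `m` discovered vertices give at most `m (K + 2)^2` dangerous
pairs (`Valid.card_dangerousSet_le`).

Three potentials, none increasing in expectation under any query, bound the three ways to a hit: too
many discovered vertices (a first moment), a large old degree (an exponential moment), and a hit
while both are small (a union bound over dangerous pairs). Their sum is at least `1` at a hit, so
its initial value bounds the success probability (`measure_isContained_le`). With `L = log (1/p)`,
`K` about `4L` and `m` of order `1/(p L^2)`, this excludes `N` up to order `p^(-2) / L^2`, which is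
stronger than the required `p^(-2) / ℓ^4`. -/

namespace SimpleGraph

open ProbabilityTheory unitInterval

/-! ### Independence of the edges of the random graph. -/

section BinomialRandom

variable {V : Type*}

lemma measurableSet_mem_edgeSet (e : Sym2 V) :
    MeasurableSet {G : SimpleGraph V | e ∈ G.edgeSet} :=
  measurable_set_iff.1 measurable_edgeSet e |>.setOf

/-- The σ-algebra of events that depend only on the pairs in `S`. -/
abbrev edgeSigma (S : Set (Sym2 V)) : MeasurableSpace (SimpleGraph V) :=
  MeasurableSpace.generateFrom {t | ∃ e ∈ S, {G : SimpleGraph V | e ∈ G.edgeSet} = t}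

lemma measurableSet_edgeSigma {S : Set (Sym2 V)} {e : Sym2 V} (he : e ∈ S) :
    MeasurableSet[edgeSigma S] {G : SimpleGraph V | e ∈ G.edgeSet} :=
  MeasurableSpace.measurableSet_generateFrom ⟨e, he, rfl⟩

lemma edgeSigma_le {S : Set (Sym2 V)} : edgeSigma S ≤
    (inferInstance : MeasurableSpace (SimpleGraph V)) :=
  MeasurableSpace.generateFrom_le (by rintro _ ⟨e, -, rfl⟩; exact measurableSet_mem_edgeSet e)

/-- The event that the pairs in `Q` are edges precisely when they belong to `E`. -/
def agreeing (Q E : Finset (Sym2 V)) : Set (SimpleGraph V) :=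
  {G | ∀ e ∈ Q, (e ∈ G.edgeSet ↔ e ∈ E)}

lemma measurableSet_agreeing (Q E : Finset (Sym2 V)) :
    MeasurableSet[edgeSigma (Q : Set (Sym2 V))] (agreeing Q E) := by
  have : agreeing Q E = ⋂ e ∈ Q, {G | e ∈ G.edgeSet ↔ e ∈ E} := by ext; simp [agreeing]
  rw [this]
  refine Finset.measurableSet_biInter _ fun e he ↦ ?_
  by_cases h : e ∈ E
  · simpa [h] using measurableSet_edgeSigma (S := (Q : Set (Sym2 V))) he
  · have := (measurableSet_edgeSigma (S := (Q : Set (Sym2 V))) he).compl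
    simp only [h, iff_false]
    exact this

variable [Countable V]

lemma binomialRandom_forall_mem_edgeSet (p : I) (s : Finset (Sym2 V))
    (hs : ∀ e ∈ s, ¬ e.IsDiag) :
    binomialRandom V p {G | ∀ e ∈ s, e ∈ G.edgeSet} =
      ∏ _e ∈ s, (toNNReal p : ENNReal) := by
  have hm : MeasurableSet {G : SimpleGraph V | ∀ e ∈ s, e ∈ G.edgeSet} := by
    have : {G : SimpleGraph V | ∀ e ∈ s, e ∈ G.edgeSet} =
        ⋂ e ∈ s, {G : SimpleGraph V | e ∈ G.edgeSet} := by ext; simp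
    rw [this]
    exact Finset.measurableSet_biInter _ fun e _ ↦ measurableSet_mem_edgeSet e
  rw [binomialRandom_eq_map, Measure.map_apply measurable_fromEdgeSet hm, setBernoulli_apply']
  have : ((fun q : Sym2 V → Prop ↦ {i | q i}) ⁻¹' (fromEdgeSet ⁻¹'
      {G : SimpleGraph V | ∀ e ∈ s, e ∈ G.edgeSet})) = Set.pi s fun _ ↦ {True} := by
    ext q
    simp only [Set.mem_preimage, Set.mem_ofPred_eq, edgeSet_fromEdgeSet, Set.mem_pi,
      Finset.mem_coe, Set.mem_singleton_iff, eq_iff_iff, iff_true]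
    refine forall₂_congr fun e he ↦ ?_
    simp [hs e he]
  rw [this, Measure.infinitePi_pi _ (fun _ _ ↦ measurableSet_singleton _)]
  refine Finset.prod_congr rfl fun e he ↦ ?_
  simp [hs e he]

lemma binomialRandom_mem_edgeSet (p : I) {e : Sym2 V} (he : ¬ e.IsDiag) :
    binomialRandom V p {G | e ∈ G.edgeSet} = (toNNReal p : ENNReal) := by
  simpa using binomialRandom_forall_mem_edgeSet p {e} (by simpa using he)

lemma iIndepSet_mem_edgeSet (p : I) :
    iIndepSet (fun e : Sym2 V ↦ {G : SimpleGraph V | e ∈ G.edgeSet}) (binomialRandom V p) := by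
  rw [iIndepSet_iff_meas_biInter measurableSet_mem_edgeSet]
  intro s
  by_cases hs : ∀ e ∈ s, ¬ e.IsDiag
  · rw [Finset.prod_congr rfl fun e he ↦ binomialRandom_mem_edgeSet p (hs e he),
      ← binomialRandom_forall_mem_edgeSet p s hs]
    congr 1
    ext; simp
  · push Not at hs
    obtain ⟨e, he, hd⟩ := hs
    -- A diagonal pair is never an edge, so both sides vanish.
    have h0 : {G : SimpleGraph V | e ∈ G.edgeSet} = ∅ := by
      ext G
      simpa using fun h ↦ G.not_isDiag_of_mem_edgeSet h hd
    rw [Finset.prod_eq_zero he (by simp [h0])]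
    refine measure_mono_null (Set.iInter₂_subset e he) (by simp [h0])

/-- This is why the answer to a fresh query is independent of all earlier answers. -/
lemma binomialRandom_inter (p : I) {S T : Set (Sym2 V)} (hST : Disjoint S T)
    {A B : Set (SimpleGraph V)} (hA : MeasurableSet[edgeSigma S] A)
    (hB : MeasurableSet[edgeSigma T] B) :
    (binomialRandom V p).real (A ∩ B) =
      (binomialRandom V p).real A * (binomialRandom V p).real B := by
  have := (Indep_iff _ _ _).1 ((iIndepSet_mem_edgeSet p).indep_generateFrom_of_disjoint
    measurableSet_mem_edgeSet S T hST) A B hA hB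
  simp [measureReal_def, this]

lemma binomialRandom_real_mem_edgeSet (p : I) {e : Sym2 V} (he : ¬ e.IsDiag) :
    (binomialRandom V p).real {G | e ∈ G.edgeSet} = p := by
  simp [measureReal_def, binomialRandom_mem_edgeSet p he]

lemma binomialRandom_agreeing_yes [DecidableEq V] (p : I) (Q E : Finset (Sym2 V)) {e : Sym2 V}
    (he : ¬ e.IsDiag) (hQ : e ∉ Q) :
    (binomialRandom V p).real (agreeing (insert e Q) (insert e E)) =
      p * (binomialRandom V p).real (agreeing Q E) := by
  have : agreeing (insert e Q) (insert e E) = {G | e ∈ G.edgeSet} ∩ agreeing Q E := by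
    ext G
    simp only [agreeing, Finset.mem_insert, Set.mem_ofPred_eq, Set.mem_inter_iff,
      forall_eq_or_imp, true_or, iff_true]
    refine and_congr_right fun _ ↦ forall₂_congr fun f hf ↦ ?_
    have : f ≠ e := by rintro rfl; exact hQ hf
    simp [this]
  rw [this, binomialRandom_inter p (S := {e}) (T := Q) (by simpa using hQ)
    (measurableSet_edgeSigma rfl) (measurableSet_agreeing Q E),
    binomialRandom_real_mem_edgeSet p he]

lemma binomialRandom_agreeing_no [DecidableEq V] (p : I) (Q E : Finset (Sym2 V)) {e : Sym2 V}
    (he : ¬ e.IsDiag) (hQ : e ∉ Q) (hE : e ∉ E) :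
    (binomialRandom V p).real (agreeing (insert e Q) E) =
      (1 - p) * (binomialRandom V p).real (agreeing Q E) := by
  have : agreeing (insert e Q) E = {G | e ∈ G.edgeSet}ᶜ ∩ agreeing Q E := by
    ext G
    simp [agreeing, hE]
  rw [this, binomialRandom_inter p (S := {e}) (T := Q) (by simpa using hQ)
    (measurableSet_edgeSigma (Set.mem_singleton e)).compl (measurableSet_agreeing Q E),
    probReal_compl_eq_one_sub (measurableSet_mem_edgeSet e), binomialRandom_real_mem_edgeSet p he]

end BinomialRandom

end SimpleGraph

/-! ### Finitely many queries suffice for some strategy. -/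

section Existence

open SimpleGraph

/-- The `j`-th block of `6` consecutive vertices of `G` spans a copy of `H`. -/
def blockContains (H : SimpleGraph (Fin 6)) (j : ℕ) : Set (SimpleGraph ℕ) :=
  {G | ∀ e ∈ H.edgeSet, e.map (fun i : Fin 6 ↦ 6 * j + (i : ℕ)) ∈ G.edgeSet}

lemma block_injective (j : ℕ) : Function.Injective (fun i : Fin 6 ↦ 6 * j + (i : ℕ)) := by
  intro a b h
  ext
  simpa using h

lemma blockContains_eq (H : SimpleGraph (Fin 6)) (j : ℕ) :
    blockContains H j = {G | ∀ e ∈ (Set.toFinite H.edgeSet).toFinset.image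
      (Sym2.map fun i : Fin 6 ↦ 6 * j + (i : ℕ)), e ∈ G.edgeSet} := by
  ext G
  simp [blockContains]

lemma measurableSet_blockContains (H : SimpleGraph (Fin 6)) (j : ℕ) :
    MeasurableSet[edgeSigma {e : Sym2 ℕ | ∀ v ∈ e, v / 6 = j}] (blockContains H j) := by
  have : blockContains H j = ⋂ e ∈ (Set.toFinite H.edgeSet).toFinset,
      {G | e.map (fun i : Fin 6 ↦ 6 * j + (i : ℕ)) ∈ G.edgeSet} := by
    ext; simp [blockContains]
  rw [this]
  refine Finset.measurableSet_biInter _ fun e _ ↦ measurableSet_edgeSigma ?_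
  simp only [Set.mem_ofPred_eq, Sym2.mem_map]
  rintro _ ⟨i, -, rfl⟩
  omega

lemma binomialRandom_blockContains (p : unitInterval) (H : SimpleGraph (Fin 6)) (j : ℕ) :
    (binomialRandom ℕ p).real (blockContains H j) = (p : ℝ) ^ H.edgeSet.ncard := by
  rw [blockContains_eq, measureReal_def, binomialRandom_forall_mem_edgeSet]
  · rw [Finset.prod_const, Finset.card_image_of_injective _ (Sym2.map.injective (block_injective j)),
      ← Set.ncard_eq_toFinset_card]
    simp
  · simp only [Finset.mem_image, Set.Finite.mem_toFinset]
    rintro _ ⟨e, he, rfl⟩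
    rw [Sym2.isDiag_map (block_injective j)]
    exact H.not_isDiag_of_mem_edgeSet he

lemma measurableSet_iInter_compl_blockContains (H : SimpleGraph (Fin 6)) (n : ℕ) :
    MeasurableSet[edgeSigma {e : Sym2 ℕ | ∀ v ∈ e, v / 6 < n}]
      (⋂ j ∈ Finset.range n, (blockContains H j)ᶜ) := by
  refine Finset.measurableSet_biInter _ fun j hj ↦ MeasurableSet.compl ?_
  refine MeasurableSpace.generateFrom_mono ?_ _ (measurableSet_blockContains H j)
  rintro _ ⟨e, he, rfl⟩
  exact ⟨e, fun v hv ↦ (he v hv).trans_lt (Finset.mem_range.1 hj), rfl⟩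

/-- Different blocks share no vertex, so they fail independently. -/
lemma binomialRandom_iInter_compl_blockContains (p : unitInterval) (H : SimpleGraph (Fin 6))
    (n : ℕ) :
    (binomialRandom ℕ p).real (⋂ j ∈ Finset.range n, (blockContains H j)ᶜ) =
      (1 - (p : ℝ) ^ H.edgeSet.ncard) ^ n := by
  induction n with
  | zero => simp
  | succ n ih =>
    have hd : Disjoint {e : Sym2 ℕ | ∀ v ∈ e, v / 6 = n} {e : Sym2 ℕ | ∀ v ∈ e, v / 6 < n} := by
      rw [Set.disjoint_left]
      intro e
      induction e with | _ a b =>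
      intro h h'
      have := h a (by simp)
      have := h' a (by simp)
      omega
    rw [Finset.range_add_one, Finset.set_biInter_insert,
      binomialRandom_inter p hd (measurableSet_blockContains H n).compl
        (measurableSet_iInter_compl_blockContains H n), ih,
      probReal_compl_eq_one_sub (edgeSigma_le _ (measurableSet_blockContains H n)),
      binomialRandom_blockContains, pow_succ']

/-- The non-adaptive strategy that queries the pairs in the order in which `f` lists them. -/
def QueryStrategy.list (f : ℕ → Sym2 ℕ) : QueryStrategy := fun l ↦ f l.length

lemma QueryStrategy.length_answers (S : QueryStrategy) (G : SimpleGraph ℕ) (n : ℕ) :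
    (S.answers G n).length = n := by
  induction n with
  | zero => rfl
  | succ n ih => simp [QueryStrategy.answers, ih]

lemma QueryStrategy.list_query (f : ℕ → Sym2 ℕ) (G : SimpleGraph ℕ) (n : ℕ) :
    (QueryStrategy.list f).query G n = f n := by
  simp [QueryStrategy.query, QueryStrategy.list, QueryStrategy.length_answers]

lemma QueryStrategy.built_mono (S : QueryStrategy) (G : SimpleGraph ℕ) : Monotone (S.built G) := by
  intro a b hab
  refine fromEdgeSet_mono ?_
  rintro e ⟨he, n, hn, rfl⟩
  exact ⟨he, n, hn.trans_le hab, rfl⟩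

lemma exists_isContained_built_of_blockContains {f : ℕ → Sym2 ℕ} (hf : Function.Surjective f)
    (H : SimpleGraph (Fin 6)) {j : ℕ} {G : SimpleGraph ℕ} (hG : G ∈ blockContains H j) :
    ∃ N, H.IsContained ((QueryStrategy.list f).built G N) := by
  choose g hg using hf
  obtain ⟨N, hN⟩ := ((Set.toFinite H.edgeSet).image
    fun e ↦ g (e.map fun i : Fin 6 ↦ 6 * j + (i : ℕ))).bddAbove
  refine ⟨N + 1, ⟨⟨⟨fun i ↦ 6 * j + (i : ℕ), ?_⟩, block_injective j⟩⟩⟩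
  intro a b hab
  have hm := hG s(a, b) hab
  have hle := hN ⟨s(a, b), hab, rfl⟩
  simp only [Sym2.map_mk] at hm hle
  simp only [QueryStrategy.built, fromEdgeSet_adj, Set.mem_ofPred_eq]
  refine ⟨⟨hm, g s(6 * j + (a : ℕ), 6 * j + (b : ℕ)), by simpa using Nat.lt_succ_of_le hle, ?_⟩, ?_⟩
  · rw [QueryStrategy.list_query, hg]
  · exact (block_injective j).ne hab.ne

/-- If `p > 0` then every graph on six vertices can be found in finitely many queries. -/
theorem exists_canFindIn (H : SimpleGraph (Fin 6)) (p : unitInterval) (hp : 0 < (p : ℝ)) :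
    ∃ N, CanFindIn H p N := by
  obtain ⟨f, hf⟩ := exists_surjective_nat (Sym2 ℕ)
  set μ := binomialRandom ℕ p
  let S := QueryStrategy.list f
  let A : ℕ → Set (SimpleGraph ℕ) := fun N ↦ {G | H.IsContained (S.built G N)}
  have hA : Monotone A := fun a b hab G hG ↦ IsContained.mono_right hG (S.built_mono G hab)
  have hlim := tendsto_measure_iUnion_atTop (μ := μ) hA
  have hU : μ (⋃ N, A N) = 1 := by
    have hfull : μ (⋃ N, A N)ᶜ = 0 := by
      -- If no copy is ever built, the first `n` blocks all fail, for every `n`. The probability of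
      -- this tends to `0`.
      rw [← measureReal_eq_zero_iff]
      refine le_antisymm (ge_of_tendsto' (x := Filter.atTop)
        (f := fun n : ℕ ↦ (1 - (p : ℝ) ^ H.edgeSet.ncard) ^ n)
        (tendsto_pow_atTop_nhds_zero_of_lt_one ?_ ?_) fun n ↦ ?_) measureReal_nonneg
      · simpa using pow_le_one₀ p.2.1 p.2.2
      · simpa using pow_pos hp _
      · rw [← binomialRandom_iInter_compl_blockContains]
        refine measureReal_mono ?_
        intro G hG
        simp only [Set.mem_iInter]
        intro j _ hj
        obtain ⟨N, hN⟩ := exists_isContained_built_of_blockContains hf H hj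
        exact hG (Set.mem_iUnion.2 ⟨N, hN⟩)
    have h1 : (1 : ENNReal) ≤ μ (⋃ N, A N) + μ (⋃ N, A N)ᶜ := by
      rw [← measure_univ (μ := μ), ← Set.union_compl_self (⋃ N, A N)]
      exact measure_union_le _ _
    rw [hfull, add_zero] at h1
    exact le_antisymm prob_le_one h1
  rw [hU] at hlim
  have hlim' : Filter.Tendsto (fun N ↦ μ.real (A N)) Filter.atTop (nhds 1) := by
    rw [← ENNReal.toReal_one]
    exact (ENNReal.tendsto_toReal ENNReal.one_ne_top).comp hlim
  obtain ⟨N, hN⟩ := (hlim'.eventually (lt_mem_nhds (show (1 / 2 : ℝ) < 1 by norm_num))).exists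
  exact ⟨N, S, hN.le⟩

end Existence

/-! ### Explorations, parents and dangerous pairs. -/

/-- The record of an exploration of a graph by edge queries. -/
structure Exploration where
  /-- the edges found -/
  E : Finset (Sym2 ℕ)
  /-- the (non-diagonal) pairs queried -/
  Q : Finset (Sym2 ℕ)
  /-- the vertices incident with an edge found -/
  V : Finset ℕ
  /-- the edges both of whose ends were already incident with edges when they were found -/
  old : Finset (Sym2 ℕ)
  /-- the other end of the edge by which a vertex was discovered -/
  par : ℕ → Option ℕ
  /-- whether a dangerous pair turned out to be an edge -/
  hit : Prop

namespace Exploration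

/-- The exploration before the first query. -/
def init : Exploration := ⟨∅, ∅, ∅, ∅, fun _ ↦ none, False⟩

/-- A pair is dangerous if its ends have a common neighbour that is not the parent of both. -/
def Dangerous (σ : Exploration) (e : Sym2 ℕ) : Prop :=
  ∃ u v w, e = s(u, v) ∧ s(u, w) ∈ σ.E ∧ s(v, w) ∈ σ.E ∧ ¬ (σ.par u = some w ∧ σ.par v = some w)

/-- The exploration after the pair `e` was found not to be an edge. -/
def no (σ : Exploration) (e : Sym2 ℕ) : Exploration := { σ with Q := insert e σ.Q }

/-- The exploration after `ab` was found to be an edge. -/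
def yes (σ : Exploration) (a b : ℕ) : Exploration where
  E := insert s(a, b) σ.E
  Q := insert s(a, b) σ.Q
  V := insert a (insert b σ.V)
  old := if a ∈ σ.V ∧ b ∈ σ.V then insert s(a, b) σ.old else σ.old
  -- When both ends are new, only `b` receives a parent.
  par := if b ∉ σ.V then Function.update σ.par b (some a)
    else if a ∉ σ.V then Function.update σ.par a (some b) else σ.par
  hit := σ.hit ∨ σ.Dangerous s(a, b)

lemma par_yes_of_mem (σ : Exploration) (a b : ℕ) {x : ℕ} (hx : x ∈ σ.V) :
    (σ.yes a b).par x = σ.par x := by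
  simp only [yes]
  split_ifs with hb ha
  · rfl
  · exact Function.update_of_ne (by rintro rfl; exact ha hx) _ _
  · exact Function.update_of_ne (by rintro rfl; exact hb hx) _ _

/-- The properties shared by all explorations that can occur. -/
structure Valid (σ : Exploration) : Prop where
  E_subset : σ.E ⊆ σ.Q
  not_isDiag : ∀ e ∈ σ.Q, ¬ e.IsDiag
  mem_V : ∀ u v, s(u, v) ∈ σ.E → u ∈ σ.V
  old_subset : σ.old ⊆ σ.E
  cover : ∀ u v, s(u, v) ∈ σ.E → s(u, v) ∈ σ.old ∨ σ.par u = some v ∨ σ.par v = some u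
  triangle : ¬ σ.hit → ∀ u v w, s(u, v) ∈ σ.E → s(u, w) ∈ σ.E → s(v, w) ∈ σ.E →
    (σ.par u = some w ∧ σ.par v = some w) ∨ (σ.par u = some v ∧ σ.par w = some v) ∨
      (σ.par v = some u ∧ σ.par w = some u)

lemma valid_init : init.Valid := by
  constructor <;> simp [init]

variable {σ : Exploration}

lemma Valid.mem_V' (h : σ.Valid) {u v : ℕ} (huv : s(u, v) ∈ σ.E) : v ∈ σ.V :=
  h.mem_V v u (by rwa [Sym2.eq_swap])

lemma Valid.ne (h : σ.Valid) {u v : ℕ} (huv : s(u, v) ∈ σ.E) : u ≠ v := by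
  simpa using h.not_isDiag _ (h.E_subset huv)

lemma Valid.no (h : σ.Valid) {e : Sym2 ℕ} (he : ¬ e.IsDiag) : (σ.no e).Valid where
  E_subset := h.E_subset.trans (Finset.subset_insert _ _)
  not_isDiag := by
    intro f hf
    rcases Finset.mem_insert.1 hf with rfl | hf
    · exact he
    · exact h.not_isDiag f hf
  mem_V := h.mem_V
  old_subset := h.old_subset
  cover := h.cover
  triangle := h.triangle

/-- The other two sides of the triangle were found earlier, and the parent of a discovered vertex
never changes. Were `w` not the parent of both ends, the new pair would have been dangerous. -/
lemma Valid.apex_of_new (h : σ.Valid) {a b u v w : ℕ}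
    (hd : ¬ σ.Dangerous s(a, b)) (huv : s(u, v) = s(a, b))
    (huw : s(u, w) ∈ (σ.yes a b).E) (hvw : s(v, w) ∈ (σ.yes a b).E) (hu : u ≠ w) (hv : v ≠ w) :
    (σ.yes a b).par u = some w ∧ (σ.yes a b).par v = some w := by
  have huw' : s(u, w) ∈ σ.E := by
    refine (Finset.mem_insert.1 huw).resolve_left ?_
    rw [← huv]
    simp only [Sym2.eq_iff]
    omega
  have hvw' : s(v, w) ∈ σ.E := by
    refine (Finset.mem_insert.1 hvw).resolve_left ?_
    rw [← huv]
    simp only [Sym2.eq_iff]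
    omega
  rw [par_yes_of_mem _ _ _ (h.mem_V _ _ huw'), par_yes_of_mem _ _ _ (h.mem_V _ _ hvw')]
  by_contra hn
  exact hd ⟨u, v, w, huv.symm, huw', hvw', hn⟩

lemma Valid.yes (h : σ.Valid) {a b : ℕ} (hab : a ≠ b) : (σ.yes a b).Valid where
  E_subset := Finset.insert_subset_insert _ h.E_subset
  not_isDiag := by
    intro f hf
    rcases Finset.mem_insert.1 hf with rfl | hf
    · simpa using hab
    · exact h.not_isDiag f hf
  mem_V := by
    intro u v huv
    rcases Finset.mem_insert.1 huv with he | he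
    · rcases Sym2.eq_iff.1 he with ⟨rfl, rfl⟩ | ⟨rfl, rfl⟩ <;> simp [Exploration.yes]
    · simp [Exploration.yes, h.mem_V u v he]
  old_subset := by
    simp only [Exploration.yes]
    split_ifs
    · exact Finset.insert_subset_insert _ h.old_subset
    · exact h.old_subset.trans (Finset.subset_insert _ _)
  cover := by
    intro u v huv
    rcases Finset.mem_insert.1 huv with he | he
    · by_cases hb : b ∈ σ.V
      · by_cases ha : a ∈ σ.V
        · left; simp [Exploration.yes, ha, hb, he]
        · right
          rcases Sym2.eq_iff.1 he with ⟨rfl, rfl⟩ | ⟨rfl, rfl⟩ <;> simp [Exploration.yes, ha, hb]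
      · right
        rcases Sym2.eq_iff.1 he with ⟨rfl, rfl⟩ | ⟨rfl, rfl⟩ <;> simp [Exploration.yes, hb]
    · rw [par_yes_of_mem _ _ _ (h.mem_V _ _ he), par_yes_of_mem _ _ _ (h.mem_V' he)]
      refine (h.cover u v he).imp_left fun ho ↦ ?_
      simp only [Exploration.yes]
      split_ifs
      · exact Finset.mem_insert_of_mem ho
      · exact ho
  triangle := by
    intro hh u v w huv huw hvw
    simp only [Exploration.yes, not_or] at hh
    have ne : ∀ {x y}, s(x, y) ∈ (σ.yes a b).E → x ≠ y := by
      intro x y hxy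
      rcases Finset.mem_insert.1 hxy with he | he
      · rcases Sym2.eq_iff.1 he with ⟨rfl, rfl⟩ | ⟨rfl, rfl⟩
        exacts [hab, hab.symm]
      · exact h.ne he
    have sw : ∀ {x y}, s(x, y) ∈ (σ.yes a b).E → s(y, x) ∈ (σ.yes a b).E := by
      intro x y hxy; rwa [Sym2.eq_swap]
    rcases Finset.mem_insert.1 huv with he | he
    · exact .inl (h.apex_of_new hh.2 he huw hvw (ne huw) (ne hvw))
    rcases Finset.mem_insert.1 huw with he' | he'
    · exact .inr (.inl (h.apex_of_new hh.2 he' huv (sw hvw) (ne huv) (ne hvw).symm))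
    rcases Finset.mem_insert.1 hvw with he'' | he''
    · exact .inr (.inr (h.apex_of_new hh.2 he'' (sw huv) (sw huw) (ne huv).symm (ne huw).symm))
    rw [par_yes_of_mem _ _ _ (h.mem_V _ _ he), par_yes_of_mem _ _ _ (h.mem_V' he),
      par_yes_of_mem _ _ _ (h.mem_V' he')]
    exact h.triangle hh.1 u v w he he' he''

/-- A triangle each of whose edges lies in a further triangle cannot be found unless a dangerous
pair turns out to be an edge. -/
lemma Valid.hit_of_triforce (h : σ.Valid) {a b c x y z : ℕ}
    (hab : s(a, b) ∈ σ.E) (hbc : s(b, c) ∈ σ.E) (hac : s(a, c) ∈ σ.E)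
    (hxa : s(x, a) ∈ σ.E) (hxb : s(x, b) ∈ σ.E) (hyb : s(y, b) ∈ σ.E) (hyc : s(y, c) ∈ σ.E)
    (hza : s(z, a) ∈ σ.E) (hzc : s(z, c) ∈ σ.E) (hxc : x ≠ c) (hya : y ≠ a) (hzb : z ≠ b) :
    σ.hit := by
  by_contra hh
  -- When `w` is the parent of `u` and `v`, any apex of the triangle `tuv` is the parent of `u` or
  -- `v`, hence equals `w`. But `w` differs from `t`, `u` and `v`.
  have key : ∀ {u v w t : ℕ}, s(u, v) ∈ σ.E → s(u, w) ∈ σ.E → s(v, w) ∈ σ.E →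
      s(t, u) ∈ σ.E → s(t, v) ∈ σ.E → t ≠ w → ¬ (σ.par u = some w ∧ σ.par v = some w) := by
    rintro u v w t huv huw hvw htu htv htw ⟨h1, h2⟩
    have e1 := h.ne huw
    have e2 := h.ne hvw
    rcases h.triangle hh t u v htu htv huv with ⟨-, h4⟩ | ⟨-, h4⟩ | ⟨h3, -⟩
    · rw [h1] at h4; exact e2 (Option.some.inj h4).symm
    · rw [h2] at h4; exact e1 (Option.some.inj h4).symm
    · rw [h1] at h3; exact htw (Option.some.inj h3).symm
  have sw : ∀ {x y}, s(x, y) ∈ σ.E → s(y, x) ∈ σ.E := by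
    intro x y hxy; rwa [Sym2.eq_swap]
  rcases h.triangle hh a b c hab hac hbc with h1 | h1 | h1
  · exact key hab hac hbc hxa hxb hxc h1
  · exact key hac hab (sw hbc) hza hzc hzb h1
  · exact key hbc (sw hab) (sw hac) hyb hyc hya h1

/-! ### Counting dangerous pairs. -/

/-- The number of old edges at a vertex. -/
def oldDegree (σ : Exploration) (b : ℕ) : ℕ := (σ.old.filter (b ∈ ·)).card

/-- The number of discovered vertices `c` such that the pair `bc` has been queried. -/
def queryDegree (σ : Exploration) (b : ℕ) : ℕ := (σ.V.filter (s(b, ·) ∈ σ.Q)).card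

/-- The neighbours of a vertex other than its children. -/
def up (σ : Exploration) (w : ℕ) : Finset ℕ :=
  σ.V.filter fun u ↦ s(u, w) ∈ σ.E ∧ σ.par u ≠ some w

/-- By `cover`, an edge at `w` that does not lead to a child is old or leads to the parent of `w`.
-/
lemma Valid.card_up_le (h : σ.Valid) (w : ℕ) : (σ.up w).card ≤ σ.oldDegree w + 1 := by
  have hsub : σ.up w ⊆ σ.V.filter (fun u ↦ s(u, w) ∈ σ.old) ∪ (σ.par w).toFinset := by
    intro u hu
    simp only [up, Finset.mem_filter] at hu
    rcases h.cover u w hu.2.1 with h1 | h1 | h1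
    · simp [hu.1, h1]
    · exact absurd h1 hu.2.2
    · simp [h1]
  refine (Finset.card_le_card hsub).trans ((Finset.card_union_le _ _).trans (add_le_add ?_ ?_))
  · refine Finset.card_le_card_of_injOn (fun u ↦ s(u, w)) ?_ ?_
    · intro u hu
      simp at hu ⊢
      exact hu.2
    · intro u _ v _ huv
      exact Sym2.congr_left.1 huv
  · cases σ.par w <;> simp

open Classical in
/-- The set of dangerous pairs. -/
noncomputable def dangerousSet (σ : Exploration) : Finset (Sym2 ℕ) :=
  σ.V.sym2.filter σ.Dangerous

lemma Valid.mem_dangerousSet (h : σ.Valid) {e : Sym2 ℕ} :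
    e ∈ σ.dangerousSet ↔ σ.Dangerous e := by
  simp only [dangerousSet, Finset.mem_filter, and_iff_right_iff_imp]
  rintro ⟨u, v, w, rfl, hu, hv, -⟩
  simpa using ⟨h.mem_V _ _ hu, h.mem_V _ _ hv⟩

/-- A dangerous pair with common neighbour `w` contains at most one child of `w`. If it contains
none, charge it to `w`, at most `(K + 1)^2` times. If it contains one, charge it to that child,
which determines `w`, at most `K + 1` times. -/
lemma Valid.card_dangerousSet_le (h : σ.Valid) {K : ℕ} (hK : ∀ w, σ.oldDegree w ≤ K) :
    σ.dangerousSet.card ≤ σ.V.card * (K + 2) ^ 2 := by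
  have hup : ∀ w, (σ.up w).card ≤ K + 1 := fun w ↦ (h.card_up_le w).trans (by simpa using hK w)
  have hsub : σ.dangerousSet ⊆
      (σ.V.biUnion fun w ↦ (σ.up w ×ˢ σ.up w).image fun q ↦ s(q.1, q.2)) ∪
      (σ.V.biUnion fun v ↦ ((σ.par v).toFinset.biUnion σ.up).image fun u ↦ s(u, v)) := by
    intro e he
    obtain ⟨u, v, w, rfl, hu, hv, hn⟩ := h.mem_dangerousSet.1 he
    simp only [Finset.mem_union, Finset.mem_biUnion, Finset.mem_image, Finset.mem_product,
      Prod.exists]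
    have huV := h.mem_V _ _ hu
    have hvV := h.mem_V _ _ hv
    by_cases h1 : σ.par u = some w
    · have h2 : σ.par v ≠ some w := fun h2 ↦ hn ⟨h1, h2⟩
      exact .inr ⟨u, huV, v, ⟨w, by simp [h1], by simp [up, hvV, hv, h2]⟩, Sym2.eq_swap⟩
    · have hu' : u ∈ σ.up w := by simp [up, huV, hu, h1]
      by_cases h2 : σ.par v = some w
      · exact .inr ⟨v, hvV, u, ⟨w, by simp [h2], hu'⟩, rfl⟩
      · exact .inl ⟨w, h.mem_V' hu, u, v, ⟨hu', by simp [up, hvV, hv, h2]⟩, rfl⟩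
  refine (Finset.card_le_card hsub).trans ((Finset.card_union_le _ _).trans ?_)
  have h1 : (σ.V.biUnion fun w ↦ (σ.up w ×ˢ σ.up w).image fun q ↦ s(q.1, q.2)).card ≤
      σ.V.card * ((K + 1) * (K + 1)) := by
    refine Finset.card_biUnion_le_card_mul _ _ _ fun w _ ↦ Finset.card_image_le.trans ?_
    rw [Finset.card_product]
    exact Nat.mul_le_mul (hup w) (hup w)
  have h2 : (σ.V.biUnion fun v ↦ ((σ.par v).toFinset.biUnion σ.up).image fun u ↦ s(u, v)).card ≤
      σ.V.card * (K + 1) := by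
    refine Finset.card_biUnion_le_card_mul _ _ _ fun v _ ↦ Finset.card_image_le.trans ?_
    cases σ.par v with
    | none => simp
    | some w => simpa using hup w
  nlinarith [Nat.zero_le (σ.V.card)]

/-! ### Running a strategy. -/

open Classical in
/-- One step of the strategy `S` in the graph `G`, on the pairs of the list of answers so far and
the exploration so far. -/
noncomputable def step (S : QueryStrategy) (G : SimpleGraph ℕ) (x : List Bool × Exploration) :
    List Bool × Exploration :=
  (x.1 ++ [decide (S x.1 ∈ G.edgeSet)],
    -- A diagonal or repeated query reveals nothing, so only the list of answers grows.
    if (S x.1).IsDiag ∨ S x.1 ∈ x.2.Q then x.2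
    else if S x.1 ∈ G.edgeSet then x.2.yes (S x.1).out.1 (S x.1).out.2 else x.2.no (S x.1))

lemma mk_out (e : Sym2 ℕ) : s(e.out.1, e.out.2) = e := Quot.out_eq e

lemma out_ne {e : Sym2 ℕ} (he : ¬ e.IsDiag) : e.out.1 ≠ e.out.2 := by
  rw [← mk_out e] at he
  simpa using he

lemma step_valid (S : QueryStrategy) (G : SimpleGraph ℕ) {x : List Bool × Exploration}
    (hx : x.2.Valid) : (step S G x).2.Valid := by
  simp only [step]
  split_ifs with h1 h2
  · exact hx
  · exact hx.yes (out_ne (by tauto))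
  · exact hx.no (by tauto)

/-- The answers to, and the exploration by, the first `n` queries of `S` in `G`. -/
lemma iterate_step_spec (S : QueryStrategy) (G : SimpleGraph ℕ) (n : ℕ) :
    ((step S G)^[n] ([], init)).1 = S.answers G n ∧
      (∀ e, e ∈ ((step S G)^[n] ([], init)).2.Q ↔ ¬ e.IsDiag ∧ ∃ i < n, S.query G i = e) ∧
      (∀ e, e ∈ ((step S G)^[n] ([], init)).2.E ↔ e ∈ G.edgeSet ∧ ∃ i < n, S.query G i = e) := by
  classical
  induction n with
  | zero => simp [QueryStrategy.answers, init]
  | succ n ih =>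
    rw [Function.iterate_succ_apply']
    set x := (step S G)^[n] ([], init)
    obtain ⟨h1, h2, h3⟩ := ih
    have hq : S x.1 = S.query G n := by rw [h1]; rfl
    have hsucc : ∀ e, (∃ i < n + 1, S.query G i = e) ↔
        (∃ i < n, S.query G i = e) ∨ S.query G n = e := by
      intro e
      simp only [Nat.lt_succ_iff_lt_or_eq, or_and_right, exists_or, exists_eq_left]
    have hdiag : ∀ e ∈ G.edgeSet, ¬ e.IsDiag := fun e he ↦ G.not_isDiag_of_mem_edgeSet he
    refine ⟨?_, ?_, ?_⟩
    · simp [step, QueryStrategy.answers, h1]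
    · intro e
      rw [hsucc]
      simp only [step, hq]
      split_ifs with c1 c2
      · rw [h2]
        rcases c1 with c1 | c1
        · grind
        · rw [h2] at c1; grind
      · simp only [yes, mk_out, Finset.mem_insert, h2]
        grind
      · simp only [no, Finset.mem_insert, h2]
        grind
    · intro e
      rw [hsucc]
      simp only [step, hq]
      split_ifs with c1 c2
      · rw [h3]
        rcases c1 with c1 | c1
        · grind
        · rw [h2] at c1; grind
      · simp only [yes, mk_out, Finset.mem_insert, h3]
        grind
      · simp only [no, h3]
        grind

lemma iterate_step_valid (S : QueryStrategy) (G : SimpleGraph ℕ) (n : ℕ) :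
    ((step S G)^[n] ([], init)).2.Valid := by
  induction n with
  | zero => exact valid_init
  | succ n ih =>
    rw [Function.iterate_succ_apply']
    exact step_valid S G ih

lemma hit_of_isContained (S : QueryStrategy) (G : SimpleGraph ℕ) (n : ℕ)
    (h : triforce.IsContained (S.built G n)) : ((step S G)^[n] ([], init)).2.hit := by
  obtain ⟨f⟩ := h
  have hE : ∀ i j, triforce.Adj i j → s(f i, f j) ∈ ((step S G)^[n] ([], init)).2.E := by
    intro i j hij
    rw [(iterate_step_spec S G n).2.2]
    have := f.toHom.map_adj hij
    simp only [QueryStrategy.built, SimpleGraph.fromEdgeSet_adj] at this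
    exact this.1
  have hne : ∀ i j, i ≠ j → f i ≠ f j := fun i j hij ↦ f.injective.ne hij
  refine (iterate_step_valid S G n).hit_of_triforce (hE 0 1 ?_) (hE 1 2 ?_) (hE 0 2 ?_)
    (hE 3 0 ?_) (hE 3 1 ?_) (hE 4 1 ?_) (hE 4 2 ?_) (hE 5 0 ?_) (hE 5 2 ?_)
    (hne 3 2 ?_) (hne 4 0 ?_) (hne 5 1 ?_) <;> simp [triforce]

end Exploration

/-! ### Supermartingales along a strategy. -/

namespace Exploration

open SimpleGraph

/-- A function of the number of remaining queries and of the exploration that does not increase in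
expectation when a pair is queried, whichever pair it is. -/
structure IsSupermartingale (p : ℝ) (Φ : ℕ → Exploration → ℝ) : Prop where
  nonneg : ∀ k σ, σ.Valid → 0 ≤ Φ k σ
  le_succ : ∀ k σ, σ.Valid → Φ k σ ≤ Φ (k + 1) σ
  query_le : ∀ k σ a b, σ.Valid → a ≠ b → s(a, b) ∉ σ.Q →
    p * Φ k (σ.yes a b) + (1 - p) * Φ k (σ.no s(a, b)) ≤ Φ (k + 1) σ

lemma IsSupermartingale.add {p : ℝ} {Φ Ψ : ℕ → Exploration → ℝ} (hΦ : IsSupermartingale p Φ)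
    (hΨ : IsSupermartingale p Ψ) : IsSupermartingale p fun k σ ↦ Φ k σ + Ψ k σ where
  nonneg k σ h := add_nonneg (hΦ.nonneg k σ h) (hΨ.nonneg k σ h)
  le_succ k σ h := add_le_add (hΦ.le_succ k σ h) (hΨ.le_succ k σ h)
  query_le k σ a b h hab hQ := by
    linarith [hΦ.query_le k σ a b h hab hQ, hΨ.query_le k σ a b h hab hQ]

/-- Induction on the remaining queries, splitting on the next answer. Weighting by the probability
of the record replaces conditioning on it, so null records need no separate treatment. -/
lemma IsSupermartingale.measure_agreeing_inter_le {p : unitInterval} {Φ : ℕ → Exploration → ℝ}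
    (hΦ : IsSupermartingale p Φ) (hhit : ∀ σ, σ.Valid → σ.hit → 1 ≤ Φ 0 σ) (S : QueryStrategy)
    (k : ℕ) (x : List Bool × Exploration) (hx : x.2.Valid) :
    (binomialRandom ℕ p).real (agreeing x.2.Q x.2.E ∩ {G | ((step S G)^[k] x).2.hit}) ≤
      (binomialRandom ℕ p).real (agreeing x.2.Q x.2.E) * Φ k x.2 := by
  induction k generalizing x with
  | zero =>
    by_cases h : x.2.hit
    · calc _ ≤ (binomialRandom ℕ p).real (agreeing x.2.Q x.2.E) * 1 := by
            rw [mul_one]; exact measureReal_mono Set.inter_subset_left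
        _ ≤ _ := mul_le_mul_of_nonneg_left (hhit _ hx h) measureReal_nonneg
    · simpa [h] using mul_nonneg measureReal_nonneg (hΦ.nonneg 0 _ hx)
  | succ k ih =>
    simp only [Function.iterate_succ_apply]
    by_cases hc : (S x.1).IsDiag ∨ S x.1 ∈ x.2.Q
    · have hstep : ∃ b : Bool, ∀ G ∈ agreeing x.2.Q x.2.E,
          step S G x = (x.1 ++ [b], x.2) := by
        rcases hc with h | h
        · refine ⟨false, fun G _ ↦ ?_⟩
          have : S x.1 ∉ G.edgeSet := fun h' ↦ G.not_isDiag_of_mem_edgeSet h' h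
          simp [step, h, this]
        · refine ⟨S x.1 ∈ x.2.E, fun G hG ↦ ?_⟩
          simp [step, h, hG _ h]
      obtain ⟨b, hb⟩ := hstep
      refine (measureReal_mono ?_).trans ((ih (x.1 ++ [b], x.2) hx).trans
        (mul_le_mul_of_nonneg_left (hΦ.le_succ k _ hx) measureReal_nonneg))
      rintro G ⟨hG, hG'⟩
      refine ⟨hG, ?_⟩
      rw [Set.mem_ofPred_eq, hb G hG] at hG'
      exact hG'
    · push Not at hc
      obtain ⟨hd, hQ⟩ := hc
      obtain ⟨a, b, hab⟩ : ∃ a b, s(a, b) = S x.1 ∧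
          x.2.yes (S x.1).out.1 (S x.1).out.2 = x.2.yes a b := ⟨_, _, mk_out _, rfl⟩
      have hne : a ≠ b := by
        have := hd
        rw [← hab.1] at this
        simpa using this
      have hE : S x.1 ∉ x.2.E := fun h ↦ hQ (hx.E_subset h)
      have hsub : agreeing x.2.Q x.2.E ∩ {G | ((step S G)^[k] (step S G x)).2.hit} ⊆
          (agreeing (x.2.yes a b).Q (x.2.yes a b).E ∩
            {G | ((step S G)^[k] (x.1 ++ [true], x.2.yes a b)).2.hit}) ∪
          (agreeing (x.2.no (S x.1)).Q (x.2.no (S x.1)).E ∩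
            {G | ((step S G)^[k] (x.1 ++ [false], x.2.no (S x.1))).2.hit}) := by
        rintro G ⟨hG, hG'⟩
        by_cases hS : S x.1 ∈ G.edgeSet
        · left
          have hst : step S G x = (x.1 ++ [true], x.2.yes a b) := by
            simp [step, hd, hQ, hS, hab.2]
          rw [Set.mem_ofPred_eq, hst] at hG'
          refine ⟨?_, hG'⟩
          intro f hf
          simp only [yes, hab.1, Finset.mem_insert] at hf ⊢
          rcases hf with rfl | hf
          · simp [hS]
          · have : f ≠ S x.1 := by rintro rfl; exact hQ hf
            simp [this, hG f hf]
        · right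
          have hst : step S G x = (x.1 ++ [false], x.2.no (S x.1)) := by
            simp [step, hd, hQ, hS]
          rw [Set.mem_ofPred_eq, hst] at hG'
          refine ⟨?_, hG'⟩
          intro f hf
          simp only [no, Finset.mem_insert] at hf ⊢
          rcases hf with rfl | hf
          · simp [hS, hE]
          · exact hG f hf
      have h1 := ih (x.1 ++ [true], x.2.yes a b) (hx.yes hne)
      have h2 := ih (x.1 ++ [false], x.2.no (S x.1)) (hx.no hd)
      have e1 : (binomialRandom ℕ p).real (agreeing (x.2.yes a b).Q (x.2.yes a b).E) =
          p * (binomialRandom ℕ p).real (agreeing x.2.Q x.2.E) := by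
        simp only [yes, hab.1]
        exact binomialRandom_agreeing_yes p _ _ hd hQ
      have e2 : (binomialRandom ℕ p).real (agreeing (x.2.no (S x.1)).Q (x.2.no (S x.1)).E) =
          (1 - p) * (binomialRandom ℕ p).real (agreeing x.2.Q x.2.E) :=
        binomialRandom_agreeing_no p _ _ hd hQ hE
      have h3 := hΦ.query_le k x.2 a b hx hne (by rwa [hab.1])
      rw [hab.1] at h3
      have h4 := mul_le_mul_of_nonneg_left h3
        (measureReal_nonneg (μ := binomialRandom ℕ p) (s := agreeing x.2.Q x.2.E))
      dsimp only at h1 h2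
      rw [e1] at h1
      rw [e2] at h2
      refine (measureReal_mono hsub).trans ((measureReal_union_le _ _).trans ?_)
      linarith

/-- The probability of finding a triforce is bounded by the initial value of any supermartingale
that is at least `1` after a hit. -/
lemma IsSupermartingale.measure_isContained_le {p : unitInterval} {Φ : ℕ → Exploration → ℝ}
    (hΦ : IsSupermartingale p Φ) (hhit : ∀ σ, σ.Valid → σ.hit → 1 ≤ Φ 0 σ) (S : QueryStrategy)
    (N : ℕ) :
    (binomialRandom ℕ p).real {G | triforce.IsContained (S.built G N)} ≤ Φ N init := by
  have h := hΦ.measure_agreeing_inter_le hhit S N ([], init) valid_init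
  have hu : agreeing init.Q init.E = (Set.univ : Set (SimpleGraph ℕ)) := by
    ext; simp [agreeing, init]
  rw [hu, Set.univ_inter, probReal_univ, one_mul] at h
  exact (measureReal_mono fun G hG ↦ hit_of_isContained S G N hG).trans h

variable {p : ℝ} {σ : Exploration}

/-! ### The number of discovered vertices -/

/-- An edge discovers at most two vertices. Division by `m + 1` makes the value at least `1` once
more than `m` are discovered. -/
lemma isSupermartingale_card_V (hp : 0 ≤ p) (m : ℕ) :
    IsSupermartingale p fun k σ ↦ (σ.V.card + 2 * p * k) / (m + 1) where
  nonneg k σ _ := by positivity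
  le_succ k σ _ := by
    push_cast
    gcongr
    linarith
  query_le k σ a b _ _ _ := by
    have h1 : ((σ.yes a b).V.card : ℝ) ≤ σ.V.card + 2 := by
      have := (Finset.card_insert_le a (insert b σ.V)).trans
        (Nat.add_le_add_right (Finset.card_insert_le b σ.V) 1)
      exact_mod_cast this
    have h2 : (σ.no s(a, b)).V = σ.V := rfl
    rw [h2, ← mul_div_assoc, ← mul_div_assoc, ← add_div]
    push_cast
    refine div_le_div_of_nonneg_right ?_ (by positivity)
    linarith [mul_le_mul_of_nonneg_left h1 hp]

/-! ### The old degrees -/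

lemma V_subset_yes (σ : Exploration) (a b : ℕ) : σ.V ⊆ (σ.yes a b).V :=
  (Finset.subset_insert _ _).trans (Finset.subset_insert _ _)

lemma old_subset_yes (σ : Exploration) (a b : ℕ) : σ.old ⊆ (σ.yes a b).old := by
  simp only [yes]
  split_ifs
  · exact Finset.subset_insert _ _
  · exact subset_rfl

lemma oldDegree_le_yes (σ : Exploration) (a b c : ℕ) : σ.oldDegree c ≤ (σ.yes a b).oldDegree c :=
  Finset.card_le_card (Finset.filter_subset_filter _ (old_subset_yes σ a b))

lemma oldDegree_yes_le (σ : Exploration) (a b c : ℕ) :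
    (σ.yes a b).oldDegree c ≤ σ.oldDegree c + 1 := by
  simp only [oldDegree, yes]
  split_ifs
  · rw [Finset.filter_insert]
    split_ifs
    · exact Finset.card_insert_le _ _
    · exact Nat.le_succ _
  · exact Nat.le_succ _

lemma oldDegree_yes_of_notMem (σ : Exploration) {a b c : ℕ} (hc : c ∉ s(a, b)) :
    (σ.yes a b).oldDegree c = σ.oldDegree c := by
  simp only [oldDegree, yes]
  split_ifs
  · rw [Finset.filter_insert, if_neg hc]
  · rfl

lemma oldDegree_yes_of_new (σ : Exploration) {a b : ℕ} (hab : ¬ (a ∈ σ.V ∧ b ∈ σ.V)) (c : ℕ) :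
    (σ.yes a b).oldDegree c = σ.oldDegree c := by
  simp only [oldDegree, yes, if_neg hab]

lemma queryDegree_mono {τ : Exploration} (hV : σ.V ⊆ τ.V) (hQ : σ.Q ⊆ τ.Q) (c : ℕ) :
    σ.queryDegree c ≤ τ.queryDegree c := by
  refine Finset.card_le_card fun x hx ↦ ?_
  simp only [Finset.mem_filter] at hx ⊢
  exact ⟨hV hx.1, hQ hx.2⟩

lemma queryDegree_lt {τ : Exploration} (hV : σ.V ⊆ τ.V) (hQ : σ.Q ⊆ τ.Q) {c d : ℕ}
    (hd : d ∈ σ.V) (hσ : s(c, d) ∉ σ.Q) (hτ : s(c, d) ∈ τ.Q) :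
    σ.queryDegree c < τ.queryDegree c := by
  refine Finset.card_lt_card (Finset.ssubset_iff_of_subset (fun x hx ↦ ?_) |>.2 ⟨d, ?_, ?_⟩)
  · simp only [Finset.mem_filter] at hx ⊢
    exact ⟨hV hx.1, hQ hx.2⟩
  · simp [hV hd, hτ]
  · simp [hσ]

lemma queryDegree_le (σ : Exploration) (c : ℕ) : σ.queryDegree c ≤ σ.V.card :=
  Finset.card_filter_le _ _

/-- The contribution of the vertex `c` to the exponential moment of the old degrees. -/
noncomputable def degreeWeight (p : ℝ) (m : ℕ) (σ : Exploration) (c : ℕ) : ℝ :=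
  2 ^ σ.oldDegree c * (1 + p) ^ (m - σ.queryDegree c)

lemma degreeWeight_nonneg (hp : 0 ≤ p) (m : ℕ) (σ : Exploration) (c : ℕ) :
    0 ≤ degreeWeight p m σ c := by
  unfold degreeWeight; positivity

lemma degreeWeight_le (hp : 0 ≤ p) (m : ℕ) {τ : Exploration} {c : ℕ}
    (ho : τ.oldDegree c = σ.oldDegree c) (hq : σ.queryDegree c ≤ τ.queryDegree c) :
    degreeWeight p m τ c ≤ degreeWeight p m σ c := by
  unfold degreeWeight
  rw [ho]
  refine mul_le_mul_of_nonneg_left (pow_le_pow_right₀ (by linarith) (by omega)) (by positivity)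

/-- A query at `c` at most doubles the first factor with probability `p`, hence multiplies its mean
by at most `2p + (1 - p) = 1 + p`. The rise of `queryDegree` pays for this by removing a factor `1 +
p`. -/
lemma degreeWeight_query_le (hp : 0 ≤ p) (hp1 : p ≤ 1) {m : ℕ} {a b c : ℕ}
    (hm : σ.V.card ≤ m) (ha : a ∈ σ.V) (hb : b ∈ σ.V) (hQ : s(a, b) ∉ σ.Q) :
    p * degreeWeight p m (σ.yes a b) c + (1 - p) * degreeWeight p m (σ.no s(a, b)) c ≤
      degreeWeight p m σ c := by
  have hQy : σ.Q ⊆ (σ.yes a b).Q := Finset.subset_insert _ _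
  have hQn : σ.Q ⊆ (σ.no s(a, b)).Q := Finset.subset_insert _ _
  have hVy := V_subset_yes σ a b
  have hVn : σ.V ⊆ (σ.no s(a, b)).V := subset_rfl
  have h1p : 0 ≤ 1 - p := by linarith
  by_cases hc : c ∈ s(a, b)
  · obtain ⟨d, hd, hcd⟩ : ∃ d ∈ σ.V, s(c, d) = s(a, b) := by
      rcases Sym2.mem_iff.1 hc with rfl | rfl
      · exact ⟨b, hb, rfl⟩
      · exact ⟨a, ha, Sym2.eq_swap⟩
    have h1 : σ.queryDegree c < (σ.yes a b).queryDegree c :=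
      queryDegree_lt hVy hQy hd (by rwa [hcd]) (by simp [hcd, yes])
    have h2 : σ.queryDegree c < (σ.no s(a, b)).queryDegree c :=
      queryDegree_lt hVn hQn hd (by rwa [hcd]) (by simp [hcd, no])
    -- Needed so that the truncated exponent `m - queryDegree` really decreases.
    have h3 : σ.queryDegree c < m :=
      (h2.trans_le (queryDegree_le _ _)).trans_le hm
    obtain ⟨r, hr⟩ : ∃ r, m - σ.queryDegree c = r + 1 := ⟨m - σ.queryDegree c - 1, by omega⟩
    have hy : degreeWeight p m (σ.yes a b) c ≤ 2 ^ (σ.oldDegree c + 1) * (1 + p) ^ r := by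
      unfold degreeWeight
      gcongr
      · norm_num
      · exact oldDegree_yes_le σ a b c
      · linarith
      · omega
    have hn : degreeWeight p m (σ.no s(a, b)) c ≤ 2 ^ σ.oldDegree c * (1 + p) ^ r := by
      unfold degreeWeight
      have : (σ.no s(a, b)).oldDegree c = σ.oldDegree c := rfl
      rw [this]
      gcongr
      · linarith
      · omega
    calc _ ≤ p * (2 ^ (σ.oldDegree c + 1) * (1 + p) ^ r) +
          (1 - p) * (2 ^ σ.oldDegree c * (1 + p) ^ r) :=
          add_le_add (mul_le_mul_of_nonneg_left hy hp) (mul_le_mul_of_nonneg_left hn h1p)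
      _ = degreeWeight p m σ c := by
          unfold degreeWeight
          rw [hr]
          ring
  · have hy := degreeWeight_le hp m (oldDegree_yes_of_notMem σ hc) (queryDegree_mono hVy hQy c)
    have hn := degreeWeight_le (σ := σ) (τ := σ.no s(a, b)) hp m (c := c) rfl (queryDegree_mono hVn hQn c)
    linarith [mul_le_mul_of_nonneg_left hy hp, mul_le_mul_of_nonneg_left hn h1p]

/-- The exponential moment of the old degrees, with undiscovered vertices accounted for. -/
noncomputable def degreeMoment (p : ℝ) (m : ℕ) (σ : Exploration) : ℝ :=
  if σ.V.card ≤ m then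
    ∑ c ∈ σ.V, degreeWeight p m σ c + (m - σ.V.card : ℝ) * (1 + p) ^ m else 0

lemma degreeMoment_nonneg (hp : 0 ≤ p) (m : ℕ) (σ : Exploration) : 0 ≤ degreeMoment p m σ := by
  unfold degreeMoment
  split_ifs with h
  · have : (σ.V.card : ℝ) ≤ m := by exact_mod_cast h
    have h2 := Finset.sum_nonneg fun c (_ : c ∈ σ.V) ↦ degreeWeight_nonneg hp m σ c
    have : 0 ≤ (m - σ.V.card : ℝ) * (1 + p) ^ m := mul_nonneg (by linarith) (by positivity)
    linarith
  · exact le_rfl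

lemma degreeMoment_no_le (hp : 0 ≤ p) (m : ℕ) (σ : Exploration) (e : Sym2 ℕ) :
    degreeMoment p m (σ.no e) ≤ degreeMoment p m σ := by
  have hV : (σ.no e).V = σ.V := rfl
  unfold degreeMoment
  rw [hV]
  split_ifs
  · gcongr
    exact degreeWeight_le (σ := σ) (τ := σ.no e) hp m rfl
      (queryDegree_mono (σ := σ) (τ := σ.no e) subset_rfl (Finset.subset_insert _ _) _)
  · exact le_rfl

lemma Valid.oldDegree_eq_zero (h : σ.Valid) {c : ℕ} (hc : c ∉ σ.V) : σ.oldDegree c = 0 := by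
  rw [oldDegree, Finset.card_eq_zero, Finset.filter_eq_empty_iff]
  intro e he hce
  obtain ⟨d, rfl⟩ := hce
  exact hc (h.mem_V c d (h.old_subset he))

/-- A new vertex has old degree `0`, so its weight is at most the `(1 + p)^m` reserved for it. If
the count passes `m`, the moment drops to `0`. -/
lemma Valid.degreeMoment_yes_le_of_new (h : σ.Valid) (hp : 0 ≤ p) (m : ℕ) {a b : ℕ}
    (hab : ¬ (a ∈ σ.V ∧ b ∈ σ.V)) :
    degreeMoment p m (σ.yes a b) ≤ degreeMoment p m σ := by
  have hV := V_subset_yes σ a b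
  by_cases hm : (σ.yes a b).V.card ≤ m
  · have hm' := (Finset.card_le_card hV).trans hm
    rw [degreeMoment, degreeMoment, if_pos hm, if_pos hm', ← Finset.sum_sdiff hV]
    have h1 : ∑ c ∈ σ.V, degreeWeight p m (σ.yes a b) c ≤ ∑ c ∈ σ.V, degreeWeight p m σ c :=
      Finset.sum_le_sum fun c _ ↦ degreeWeight_le hp m (oldDegree_yes_of_new σ hab c)
        (queryDegree_mono hV (Finset.subset_insert _ _) c)
    have h2 : ∑ c ∈ (σ.yes a b).V \ σ.V, degreeWeight p m (σ.yes a b) c ≤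
        ((σ.yes a b).V \ σ.V).card • (1 + p) ^ m := by
      refine Finset.sum_le_card_nsmul _ _ _ fun c hc ↦ ?_
      unfold degreeWeight
      rw [oldDegree_yes_of_new σ hab, h.oldDegree_eq_zero (Finset.mem_sdiff.1 hc).2, pow_zero,
        one_mul]
      exact pow_le_pow_right₀ (by linarith) (Nat.sub_le _ _)
    have h3 : (((σ.yes a b).V \ σ.V).card : ℝ) = (σ.yes a b).V.card - σ.V.card := by
      rw [Finset.card_sdiff_of_subset hV, Nat.cast_sub (Finset.card_le_card hV)]
    rw [nsmul_eq_mul, h3] at h2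
    linarith
  · rw [degreeMoment, if_neg hm]
    exact degreeMoment_nonneg hp m σ

lemma isSupermartingale_degreeMoment (hp : 0 ≤ p) (hp1 : p ≤ 1) (m K : ℕ) :
    IsSupermartingale p fun _ σ ↦ degreeMoment p m σ / 2 ^ K where
  nonneg k σ _ := div_nonneg (degreeMoment_nonneg hp m σ) (by positivity)
  le_succ k σ _ := le_rfl
  query_le k σ a b h _ hQ := by
    have h1p : 0 ≤ 1 - p := by linarith
    rw [← mul_div_assoc, ← mul_div_assoc, ← add_div]
    gcongr
    have hn := degreeMoment_no_le hp m σ s(a, b)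
    by_cases hab : a ∈ σ.V ∧ b ∈ σ.V
    · have hVy : (σ.yes a b).V = σ.V := by simp [yes, hab.1, hab.2]
      have hVn : (σ.no s(a, b)).V = σ.V := rfl
      unfold degreeMoment
      rw [hVy, hVn]
      split_ifs with hm
      · have := Finset.sum_le_sum fun c (_ : c ∈ σ.V) ↦
          degreeWeight_query_le (c := c) hp hp1 hm hab.1 hab.2 hQ
        rw [Finset.sum_add_distrib, ← Finset.mul_sum, ← Finset.mul_sum] at this
        linarith
      · simp
    · have hy := h.degreeMoment_yes_le_of_new hp m hab
      linarith [mul_le_mul_of_nonneg_left hy hp, mul_le_mul_of_nonneg_left hn h1p]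

lemma le_degreeMoment (hp : 0 ≤ p) {m : ℕ} (hm : σ.V.card ≤ m) {c : ℕ} (hc : c ∈ σ.V) :
    2 ^ σ.oldDegree c ≤ degreeMoment p m σ := by
  rw [degreeMoment, if_pos hm]
  have h1 : degreeWeight p m σ c ≤ ∑ c ∈ σ.V, degreeWeight p m σ c :=
    Finset.single_le_sum (fun c _ ↦ degreeWeight_nonneg hp m σ c) hc
  have h2 : 2 ^ σ.oldDegree c ≤ degreeWeight p m σ c :=
    le_mul_of_one_le_right (by positivity) (one_le_pow₀ (by linarith))
  have hm' : (σ.V.card : ℝ) ≤ m := by exact_mod_cast hm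
  have h3 : 0 ≤ (m - σ.V.card : ℝ) * (1 + p) ^ m := mul_nonneg (by linarith) (by positivity)
  linarith

/-! ### Dangerous pairs -/

/-- At most `m` vertices have been discovered and all old degrees are at most `K`. -/
def Sparse (m K : ℕ) (σ : Exploration) : Prop :=
  σ.V.card ≤ m ∧ ∀ c, σ.oldDegree c ≤ K

lemma Sparse.of_yes {m K a b : ℕ} (h : (σ.yes a b).Sparse m K) : σ.Sparse m K :=
  ⟨(Finset.card_le_card (V_subset_yes σ a b)).trans h.1,
    fun c ↦ (oldDegree_le_yes σ a b c).trans (h.2 c)⟩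

/-- The number of dangerous pairs that have been queried. -/
noncomputable def dangerousQueries (σ : Exploration) : ℕ := (σ.Q ∩ σ.dangerousSet).card

lemma Valid.dangerousQueries_le (h : σ.Valid) {m K : ℕ} (hs : σ.Sparse m K) :
    (σ.dangerousQueries : ℝ) ≤ m * (K + 2) ^ 2 := by
  have h1 : σ.dangerousQueries ≤ m * (K + 2) ^ 2 :=
    (Finset.card_le_card Finset.inter_subset_right).trans
      ((h.card_dangerousSet_le hs.2).trans (Nat.mul_le_mul_right _ hs.1))
  exact_mod_cast h1

/-- Dangerous pairs stay dangerous, since edges persist and parents of discovered vertices are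
fixed. -/
lemma Valid.dangerousQueries_le_yes (h : σ.Valid) {a b : ℕ} (hab : a ≠ b) :
    σ.dangerousQueries ≤ (σ.yes a b).dangerousQueries := by
  refine Finset.card_le_card (Finset.inter_subset_inter (Finset.subset_insert _ _) ?_)
  intro e he
  rw [h.mem_dangerousSet] at he
  rw [(h.yes hab).mem_dangerousSet]
  obtain ⟨u, v, w, rfl, hu, hv, hn⟩ := he
  refine ⟨u, v, w, rfl, Finset.mem_insert_of_mem hu, Finset.mem_insert_of_mem hv, ?_⟩
  rwa [par_yes_of_mem _ _ _ (h.mem_V _ _ hu), par_yes_of_mem _ _ _ (h.mem_V _ _ hv)]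

open Classical in
/-- An upper bound for the probability that a dangerous pair turns out to be an edge while the
exploration is sparse. -/
noncomputable def hitBound (p : ℝ) (m K : ℕ) (σ : Exploration) : ℝ :=
  if σ.Sparse m K then if σ.hit then 1 else p * (m * (K + 2) ^ 2 - σ.dangerousQueries) else 0

lemma Valid.hitBound_nonneg (h : σ.Valid) (hp : 0 ≤ p) (m K : ℕ) : 0 ≤ hitBound p m K σ := by
  unfold hitBound
  split_ifs with hs
  · exact zero_le_one
  · exact mul_nonneg hp (sub_nonneg.2 (h.dangerousQueries_le hs))
  · exact le_rfl

lemma hitBound_le_one_of_hit (m K : ℕ) (h : σ.hit) : hitBound p m K σ ≤ 1 := by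
  unfold hitBound
  simp only [h, if_true]
  split_ifs <;> norm_num

/-- Only a dangerous query can cause a hit. It does so with probability `p`, and failing uses up one
unit of the budget `m (K + 2)^2`, worth exactly `p`. Sparseness, once lost, never returns. -/
lemma isSupermartingale_hitBound (hp : 0 ≤ p) (hp1 : p ≤ 1) (m K : ℕ) :
    IsSupermartingale p fun _ σ ↦ hitBound p m K σ where
  nonneg k σ h := h.hitBound_nonneg hp m K
  le_succ k σ _ := le_rfl
  query_le k σ a b h hab hQ := by
    have h1p : 0 ≤ 1 - p := by linarith
    have hd : ¬ (s(a, b)).IsDiag := by simpa using hab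
    by_cases hs : σ.Sparse m K
    · have hsn : (σ.no s(a, b)).Sparse m K := hs
      have hdn : (σ.no s(a, b)).dangerousSet = σ.dangerousSet := by
        ext e
        rw [(h.no hd).mem_dangerousSet, h.mem_dangerousSet]
        rfl
      by_cases hh : σ.hit
      · have hy : hitBound p m K (σ.yes a b) ≤ 1 := hitBound_le_one_of_hit m K (.inl hh)
        have hn : hitBound p m K (σ.no s(a, b)) ≤ 1 := hitBound_le_one_of_hit m K hh
        have h0 : hitBound p m K σ = 1 := by simp [hitBound, hs, hh]
        rw [h0]
        linarith [mul_le_mul_of_nonneg_left hy hp, mul_le_mul_of_nonneg_left hn h1p]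
      · have h0 : hitBound p m K σ = p * (m * (K + 2) ^ 2 - σ.dangerousQueries) := by
          simp [hitBound, hs, hh]
        have hn : hitBound p m K (σ.no s(a, b)) =
            p * (m * (K + 2) ^ 2 - (σ.no s(a, b)).dangerousQueries) := by
          have : ¬ (σ.no s(a, b)).hit := hh
          simp [hitBound, hsn, this]
        by_cases hD : σ.Dangerous s(a, b)
        · have hy : hitBound p m K (σ.yes a b) ≤ 1 := hitBound_le_one_of_hit m K (.inr hD)
          have hc : (σ.no s(a, b)).dangerousQueries = σ.dangerousQueries + 1 := by
            unfold dangerousQueries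
            rw [hdn]
            simp only [no]
            rw [Finset.insert_inter_of_mem (h.mem_dangerousSet.2 hD), Finset.card_insert_of_notMem]
            simp [hQ]
          have hle := (h.no hd).dangerousQueries_le hsn
          rw [hn, h0]
          rw [hc] at hle ⊢
          push_cast at hle ⊢
          nlinarith [mul_le_mul_of_nonneg_left hy hp,
            mul_nonneg (mul_nonneg hp hp) (sub_nonneg.2 hle)]
        · have hhy : ¬ (σ.yes a b).hit := by simp [yes, hh, hD]
          have hy : hitBound p m K (σ.yes a b) ≤ hitBound p m K σ := by
            by_cases hsy : (σ.yes a b).Sparse m K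
            · have : (σ.dangerousQueries : ℝ) ≤ (σ.yes a b).dangerousQueries := by
                exact_mod_cast h.dangerousQueries_le_yes hab
              rw [h0, hitBound, if_pos hsy, if_neg hhy]
              gcongr
            · rw [hitBound, if_neg hsy]
              exact h.hitBound_nonneg hp m K
          have hn' : hitBound p m K (σ.no s(a, b)) ≤ hitBound p m K σ := by
            rw [hn, h0]
            have : σ.dangerousQueries ≤ (σ.no s(a, b)).dangerousQueries := by
              unfold dangerousQueries
              rw [hdn]
              exact Finset.card_le_card
                (Finset.inter_subset_inter (Finset.subset_insert _ _) subset_rfl)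
            have : (σ.dangerousQueries : ℝ) ≤ (σ.no s(a, b)).dangerousQueries := by
              exact_mod_cast this
            gcongr
          linarith [mul_le_mul_of_nonneg_left hy hp, mul_le_mul_of_nonneg_left hn' h1p]
    · have hsn : ¬ (σ.no s(a, b)).Sparse m K := hs
      have hsy : ¬ (σ.yes a b).Sparse m K := fun h' ↦ hs h'.of_yes
      simp [hitBound, hs, hsn, hsy]

/-- The probability that `N` queries find a triforce. -/
theorem measure_isContained_le (p : unitInterval) (S : QueryStrategy) (N m K : ℕ) :
    (binomialRandom ℕ p).real {G | triforce.IsContained (S.built G N)} ≤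
      2 * p * N / (m + 1) + m * (1 + p) ^ m / 2 ^ K + p * (m * (K + 2) ^ 2) := by
  have hp := p.2.1
  have hp1 := p.2.2
  have hΦ := ((isSupermartingale_card_V hp m).add
    (isSupermartingale_degreeMoment hp hp1 m K)).add (isSupermartingale_hitBound hp hp1 m K)
  refine (hΦ.measure_isContained_le ?_ S N).trans (le_of_eq ?_)
  · intro σ hσ hhit
    have h1 : 0 ≤ ((σ.V.card : ℝ) + 2 * p * (0 : ℕ)) / (m + 1) :=
      (isSupermartingale_card_V hp m).nonneg 0 σ hσ
    have h2 : 0 ≤ degreeMoment p m σ / 2 ^ K :=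
      (isSupermartingale_degreeMoment hp hp1 m K).nonneg 0 σ hσ
    have h3 := hσ.hitBound_nonneg hp m K
    -- At a hit one of the three summands is at least `1`: the third if the exploration is sparse,
    -- otherwise one of the first two.
    by_cases hm : σ.V.card ≤ m
    · by_cases hK : ∀ c, σ.oldDegree c ≤ K
      · have : hitBound p m K σ = 1 := by
          have hs : σ.Sparse m K := ⟨hm, hK⟩
          simp [hitBound, hs, hhit]
        linarith
      · push Not at hK
        obtain ⟨c, hc⟩ := hK
        have hcV : c ∈ σ.V := by
          by_contra hcV
          rw [hσ.oldDegree_eq_zero hcV] at hc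
          omega
        have : 1 ≤ degreeMoment p m σ / 2 ^ K := by
          rw [one_le_div (by positivity)]
          exact (pow_le_pow_right₀ (by norm_num) hc.le).trans (le_degreeMoment hp hm hcV)
        linarith
    · have : 1 ≤ ((σ.V.card : ℝ) + 2 * p * (0 : ℕ)) / (m + 1) := by
        rw [one_le_div (by positivity)]
        have : m + 1 ≤ σ.V.card := by omega
        have : ((m : ℝ) + 1) ≤ σ.V.card := by exact_mod_cast this
        simpa using this
      linarith
  · have hs : init.Sparse m K := ⟨by simp [init], fun c ↦ by simp [oldDegree, init]⟩
    have hh : ¬ init.hit := id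
    have hV : init.V = ∅ := rfl
    have hQ : init.Q = ∅ := rfl
    simp [hitBound, hs, hh, degreeMoment, dangerousQueries, hV, hQ]

end Exploration

/-! ### Choice of parameters and conclusion. -/

/-- A triforce cannot be found in `1 / (6400 p² log² (1 / p))` queries. -/
theorem not_canFindIn_triforce {p : unitInterval} (hp : 0 < (p : ℝ)) (hp' : (p : ℝ) < 1 / 100)
    {N : ℕ} (hN : (N : ℝ) ≤ 1 / (6400 * (p : ℝ) ^ 2 * Real.log (1 / p) ^ 2)) :
    ¬ CanFindIn triforce p N := by
  rintro ⟨S, hS⟩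
  set q : ℝ := (p : ℝ) with hq
  set L := Real.log (1 / q) with hL
  have hLexp : Real.exp L = 1 / q := Real.exp_log (by positivity)
  have hL1 : 1 ≤ L := by
    rw [hL, Real.le_log_iff_exp_le (by positivity)]
    have := Real.exp_one_lt_d9
    rw [le_div_iff₀ hp]
    nlinarith
  -- These values make each of the three error terms at most `1/8`, for a total of `3/8 < 1/2`.
  set m := ⌊1 / (400 * q * L ^ 2)⌋₊
  set K := ⌈4 * L⌉₊
  have hm1 : 1 / (400 * q * L ^ 2) ≤ m + 1 := (Nat.lt_floor_add_one _).le
  have hm2 : (m : ℝ) ≤ 1 / (400 * q * L ^ 2) := Nat.floor_le (by positivity)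
  have hK1 : 4 * L ≤ K := Nat.le_ceil _
  have hK2 : (K : ℝ) + 2 ≤ 7 * L := by
    have := Nat.ceil_lt_add_one (show 0 ≤ 4 * L by positivity)
    linarith
  have hmqL : (m : ℝ) * (q * L ^ 2) ≤ 1 / 400 := by
    calc (m : ℝ) * (q * L ^ 2) ≤ 1 / (400 * q * L ^ 2) * (q * L ^ 2) := by gcongr
      _ = 1 / 400 := by field_simp
  have hmq : (m : ℝ) * q ≤ 1 := by
    have : (m : ℝ) * q * 1 ≤ (m : ℝ) * q * L ^ 2 := by
      gcongr
      nlinarith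
    linarith
  have b1 : 2 * q * N / (m + 1) ≤ 1 / 8 := by
    rw [div_le_iff₀ (by positivity)]
    calc 2 * q * N ≤ 2 * q * (1 / (6400 * q ^ 2 * L ^ 2)) := by gcongr
      _ = 1 / 8 * (1 / (400 * q * L ^ 2)) := by field_simp; norm_num
      _ ≤ _ := by gcongr
  have b2 : (m : ℝ) * (1 + q) ^ m / 2 ^ K ≤ 1 / 8 := by
    have h1 : (1 + q) ^ m ≤ 3 := by
      calc (1 + q) ^ m ≤ Real.exp q ^ m := by
            gcongr
            linarith [Real.add_one_le_exp q]
        _ = Real.exp (m * q) := (Real.exp_nat_mul _ _).symm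
        _ ≤ Real.exp 1 := Real.exp_le_exp.2 hmq
        _ ≤ 3 := by linarith [Real.exp_one_lt_d9]
    have h2 : 1 / q ^ 2 ≤ (2 : ℝ) ^ K := by
      have h2a : 2 * L ≤ K * Real.log 2 := by
        nlinarith [Real.log_two_gt_d9]
      calc 1 / q ^ 2 = Real.exp (2 * L) := by
            rw [two_mul, Real.exp_add, hLexp]; field_simp
        _ ≤ Real.exp (K * Real.log 2) := Real.exp_le_exp.2 h2a
        _ = 2 ^ K := by rw [Real.exp_nat_mul, Real.exp_log (by norm_num)]
    rw [div_le_iff₀ (by positivity)]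
    have h3 : (m : ℝ) ≤ 1 / q := by rwa [le_div_iff₀ hp]
    calc (m : ℝ) * (1 + q) ^ m ≤ 1 / q * 3 := by gcongr
      -- This amounts to `24 q ≤ 1`, which `q < 1/100` gives.
      _ ≤ 1 / 8 * (1 / q ^ 2) := by
        rw [div_mul_div_comm, div_mul_eq_mul_div, div_le_div_iff₀ (by positivity) (by positivity)]
        nlinarith [sq_nonneg q]
      _ ≤ _ := by gcongr
  have b3 : q * (m * ((K : ℝ) + 2) ^ 2) ≤ 1 / 8 := by
    calc q * (m * ((K : ℝ) + 2) ^ 2) ≤ q * (m * (7 * L) ^ 2) := by gcongr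
      _ = 49 * ((m : ℝ) * (q * L ^ 2)) := by ring
      _ ≤ 1 / 8 := by linarith
  have := Exploration.measure_isContained_le p S N m K
  linarith

lemma Real.log_pow_four_le {x : ℝ} (hx : 1 ≤ x) : Real.log x ^ 4 ≤ 16 * x ^ 2 := by
  have h0 := Real.log_nonneg hx
  have h1 : Real.log x = 2 * Real.log (√x) := by
    rw [Real.log_sqrt (by linarith)]; ring
  have h2 : Real.log (√x) ≤ √x := (Real.log_le_sub_one_of_pos (by positivity)).trans (by linarith)
  have h3 : Real.log x ≤ 2 * √x := by linarith
  calc Real.log x ^ 4 ≤ (2 * √x) ^ 4 := by gcongr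
    _ = 16 * (√x ^ 2) ^ 2 := by ring
    _ = 16 * x ^ 2 := by rw [Real.sq_sqrt (by linarith)]

theorem theorem2 :
    ∃ c : ℝ, 0 < c ∧ ∃ p₀ : ℝ, 0 < p₀ ∧ p₀ < 1 ∧
      ∀ p : unitInterval, 0 < (p : ℝ) → (p : ℝ) < p₀ →
        (∃ N : ℕ, CanFindIn triforce p N) ∧
        ∀ ℓ : ℝ, ℓ = Real.log (1 / (p : ℝ)) / (2 * Real.log (Real.log (1 / (p : ℝ)))) →
          c * ((p : ℝ) ^ (-2 : ℤ) / ℓ ^ 4) ≤ (queryNumber triforce p : ℝ) := by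
  -- In `256 = 16 * 16`, one factor comes from the `2` in `ℓ`, raised to the fourth power, and the
  -- other from `Real.log_pow_four_le`.
  refine ⟨1 / (6400 * 256), by norm_num, 1 / 100, by norm_num, by norm_num, ?_⟩
  intro p hp hp'
  have hex := exists_canFindIn triforce p hp
  refine ⟨hex, ?_⟩
  rintro ℓ rfl
  -- Existence matters here: the infimum of an empty set of naturals would be `0`.
  have hmem : CanFindIn triforce p (queryNumber triforce p) := Nat.sInf_mem hex
  have hlt : 1 / (6400 * (p : ℝ) ^ 2 * Real.log (1 / p) ^ 2) < queryNumber triforce p := by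
    by_contra hle
    exact not_canFindIn_triforce hp hp' (not_lt.1 hle) hmem
  refine le_trans ?_ hlt.le
  set q : ℝ := (p : ℝ)
  set L := Real.log (1 / q) with hL
  have hL1 : 1 < L := by
    rw [hL, Real.lt_log_iff_exp_lt (by positivity)]
    have := Real.exp_one_lt_d9
    rw [lt_div_iff₀ hp]
    nlinarith
  have hlog : 0 < Real.log L := Real.log_pos hL1
  have h4 := Real.log_pow_four_le hL1.le
  have hℓ : (q : ℝ) ^ (-2 : ℤ) / (L / (2 * Real.log L)) ^ 4 =
      16 * Real.log L ^ 4 / (q ^ 2 * L ^ 4) := by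
    rw [zpow_neg]
    have : (q : ℝ) ^ (2 : ℤ) = q ^ 2 := by norm_cast
    rw [this]
    field_simp
    norm_num
  rw [hℓ]
  calc 1 / (6400 * 256) * (16 * Real.log L ^ 4 / (q ^ 2 * L ^ 4))
      ≤ 1 / (6400 * 256) * (16 * (16 * L ^ 2) / (q ^ 2 * L ^ 4)) := by gcongr
    _ = 1 / (6400 * q ^ 2 * L ^ 2) := by field_simp; norm_num
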